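/- Let $\mathbf B$ be a commutative ring that is reduced and zero-dimensional (every prime ideal is maximal), let $\mathbf A\subseteq\mathbf B$ be a subring, let $n\ge 0$, and let $M$ be a finitely generated projective module of constant rank $1$ over $\mathbf A[\underline X]=\mathbf A[X_1,\dots,X_n]$. Write $M(0)=\mathbf A\otimes_{\mathbf A[\underline X]}M$ for the $\mathbf A$-module obtained from $M$ by the evaluation $X_1=\dots=X_n=0$. Then there are an integer $m\ge 0$ and elements $c_1,\dots,c_m\in\mathbf B$ such that, with $\mathbf A'=\mathbf A[c_1,\dots,c_m]\subseteq\mathbf B$: 1. $c_i^2$ and $c_i^3$ belong to $\mathbf A[(c_j)_{j<i}]$ for $i=1,\dots,m$; 2. if $M(0)$ is free over $\mathbf A$, then $M$ becomes free over $\mathbf A'[\underline X]$, i.e. $\mathbf A'[\underline X]\otimes_{\mathbf A[\underline X]}M$ is a free $\mathbf A'[\underline X]$-module; 3. in all cases, $M$ becomes extended over $\mathbf A'[\underline X]$ from $M(0)$, i.e. $\mathbf A'[\underline X]\otimes_{\mathbf A[\underline X]}M\;\cong\;\mathbf A'[\underline X]\otimes_{\mathbf A'}\bigl(\mathbf A'\otimes_{\mathbf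 A}M(0)\bigr)$ as $\mathbf A'[\underline X]$-modules. -/

import Mathlib

open scoped TensorProduct

/-- The change of ring of the `R`-module `M` along a ring homomorphism `f : R →+* S`, that is, the
module `S ⊗[R] M`, where `S` is an `R`-algebra through `f`. -/
def ChangeOfRing {R S : Type*} [CommRing R] [CommRing S] (f : R →+* S) (M : Type*)
    [AddCommGroup M] [Module R M] : Type _ :=
  letI : Algebra R S := f.toAlgebra
  S ⊗[R] M

namespace ChangeOfRing

variable {R S : Type*} [CommRing R] [CommRing S] (f : R →+* S) (M : Type*) [AddCommGroup M]
  [Module R M]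

noncomputable instance : AddCommGroup (ChangeOfRing f M) :=
  letI : Algebra R S := f.toAlgebra
  (TensorProduct.addCommGroup : AddCommGroup (S ⊗[R] M))

noncomputable instance : Module S (ChangeOfRing f M) :=
  letI : Algebra R S := f.toAlgebra
  (TensorProduct.leftModule : Module S (S ⊗[R] M))

end ChangeOfRing

/-- `M` is a projective module of (constant) rank `1` over `R`: finitely generated, projective, and
of rank `1` at every prime. -/
def IsProjectiveOfRankOne (R M : Type*) [CommRing R] [AddCommGroup M] [Module R M] : Prop :=
  Module.Finite R M ∧ Module.Projective R M ∧ ∀ p : PrimeSpectrum R, Module.rankAtStalk M p = 1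

/-- The module `M(0)` over `A`, obtained from the module `M = M(X)` over `A[X₁, …, Xₙ]` by the
evaluation of the variables at `0`. -/
abbrev AtZero (n : ℕ) (A M : Type*) [CommRing A] [AddCommGroup M]
    [Module (MvPolynomial (Fin n) A) M] : Type _ :=
  ChangeOfRing (MvPolynomial.constantCoeff : MvPolynomial (Fin n) A →+* A) M

/-- The module over `A'[X₁, …, Xₙ]` obtained from the module `M` over `A[X₁, …, Xₙ]` by the change
of ring that applies `f : A →+* A'` to the coefficients. -/
abbrev ChangeOfCoeffs (n : ℕ) {A A' : Type*} [CommRing A] [CommRing A'] (f : A →+* A') (M : Type*)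
    [AddCommGroup M] [Module (MvPolynomial (Fin n) A) M] : Type _ :=
  ChangeOfRing (MvPolynomial.map f : MvPolynomial (Fin n) A →+* MvPolynomial (Fin n) A') M

/-- The module over `A[X₁, …, Xₙ]` extended from the module `N` over `A`. -/
abbrev ExtendToPoly (n : ℕ) (A N : Type*) [CommRing A] [AddCommGroup N] [Module A N] : Type _ :=
  ChangeOfRing (MvPolynomial.C : A →+* MvPolynomial (Fin n) A) N

/-! Over a field, invertible modules on polynomial rings are free; idempotents glue this over a
reduced zero-dimensional ring, so `M` becomes free of rank one over `B[X]`
(`Module.Invertible.nonempty_linearEquiv_of_krullDimLE_zero`). Hence `M` is an invertible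
`A[X]`-submodule of `B[X]`, recorded by generators `f i` and generators `g i` of its inverse.
Dividing by its value at `0` yields a family with constant terms in `A`, and `M` is extended over
`A'` as soon as `A'[X]` contains all `f i * g j (0)` and `g i * f j (0)`.

If `A` is seminormal in `B`, all coefficients of such a normalized family lie in `A`
(`IsSeminormalIn.coeff_mem_range`). By Kronecker they are integral, so they generate a finite
`A`-algebra `C`, in which the conductor is radical. If it is proper, localize at a prime `p` of `A`
minimal over it: modulo the conductor, `A` becomes a field and `C` a reduced algebra over it, where
polynomial units are constants. This forces the coefficients into `A` locally at `p`, so the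
conductor is not inside `p`, a contradiction.

In general, `A` is replaced by its seminormalization in `B`; finitely many coefficients need only
finitely many of the adjunctions. -/

/-! ### Projective modules of rank one are invertible. -/

theorem Module.Projective.exists_finite_dual_family (R M : Type*) [CommRing R] [AddCommGroup M]
    [Module R M] [Module.Finite R M] [Module.Projective R M] :
    ∃ (k : ℕ) (m : Fin k → M) (ψ : Fin k → Module.Dual R M), ∀ x, ∑ i, ψ i x • m i = x := by
  obtain ⟨k, f, hf⟩ := Module.Finite.exists_fin' R M
  obtain ⟨s, hs⟩ := f.exists_rightInverse_of_surjective (LinearMap.range_eq_top.mpr hf)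
  refine ⟨k, fun i => f (Pi.single i 1), fun i => LinearMap.proj i ∘ₗ s, fun x => ?_⟩
  have hx := LinearMap.congr_fun hs x
  simp only [LinearMap.comp_apply, LinearMap.id_apply] at hx
  conv_rhs => rw [← hx, LinearMap.pi_apply_eq_sum_univ f (s x)]
  refine Finset.sum_congr rfl fun i _ => ?_
  simp only [LinearMap.comp_apply, LinearMap.proj_apply]
  congr 2
  ext j
  simp [Pi.single_apply, eq_comm]

namespace IsProjectiveOfRankOne

variable {R M : Type*} [CommRing R] [AddCommGroup M] [Module R M]

/-- Locally `M` is free on some `u`; with `x = a u` and `y = b u`, both sides are `a b ψ(u) u`. -/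
theorem smul_swap (hM : IsProjectiveOfRankOne R M) (ψ : Module.Dual R M) (x y : M) :
    ψ x • y = ψ y • x := by
  obtain ⟨_, _, hr⟩ := hM
  refine Module.eq_of_localization_maximal (R := R)
    (fun P _ => LocalizedModule P.primeCompl M)
    (fun P _ => LocalizedModule.mkLinearMap P.primeCompl M) _ _ fun P hP => ?_
  have : Module.Free (Localization.AtPrime P) (LocalizedModule P.primeCompl M) :=
    Module.free_of_flat_of_isLocalRing
  have h1 : Module.finrank (Localization.AtPrime P) (LocalizedModule P.primeCompl M) = 1 :=
    hr ⟨P, hP.isPrime⟩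
  obtain ⟨u, -, hu⟩ := finrank_eq_one_iff'.mp h1
  let ψ' : LocalizedModule P.primeCompl M →ₗ[Localization.AtPrime P] Localization.AtPrime P :=
    IsLocalizedModule.mapExtendScalars P.primeCompl (LocalizedModule.mkLinearMap P.primeCompl M)
      (Algebra.linearMap R (Localization.AtPrime P)) (Localization.AtPrime P) ψ
  have hψ (z : M) : ψ' (LocalizedModule.mkLinearMap P.primeCompl M z) =
      algebraMap R (Localization.AtPrime P) (ψ z) := by
    simp only [ψ', IsLocalizedModule.mapExtendScalars_apply_apply]
    exact IsLocalizedModule.map_apply P.primeCompl (LocalizedModule.mkLinearMap P.primeCompl M)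
      (Algebra.linearMap R (Localization.AtPrime P)) ψ z
  rw [map_smul, map_smul, ← algebraMap_smul (Localization.AtPrime P) (ψ x),
    ← algebraMap_smul (Localization.AtPrime P) (ψ y), ← hψ, ← hψ]
  obtain ⟨a, ha⟩ := hu (LocalizedModule.mkLinearMap P.primeCompl M x)
  obtain ⟨b, hb⟩ := hu (LocalizedModule.mkLinearMap P.primeCompl M y)
  rw [← ha, ← hb, map_smul, map_smul, smul_eq_mul, smul_eq_mul, smul_smul, smul_smul]
  congr 1
  ring

theorem invertible (hM : IsProjectiveOfRankOne R M) : Module.Invertible R M := by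
  have hswap := hM.smul_swap
  obtain ⟨_, _, hr⟩ := hM
  obtain ⟨k, m, ψ, hψ⟩ := Module.Projective.exists_finite_dual_family R M
  refine ⟨?_, ?_⟩
  -- By `smul_swap`, a tensor is determined by its contraction, which is therefore injective.
  · have key (t : Module.Dual R M ⊗[R] M) :
        t = contractLeft R M t • ∑ i, ψ i ⊗ₜ[R] m i := by
      induction t with
      | zero => simp
      | add a b ha hb => rw [map_add, add_smul, ← ha, ← hb]
      | tmul φ x =>
        conv_lhs => rw [← hψ x]
        rw [TensorProduct.tmul_sum, Finset.smul_sum]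
        refine Finset.sum_congr rfl fun i _ => ?_
        rw [contractLeft_apply, ← TensorProduct.smul_tmul, TensorProduct.smul_tmul']
        congr 1
        ext y
        simp only [LinearMap.smul_apply, smul_eq_mul]
        have := congrArg φ (hswap (ψ i) x y)
        simp only [map_smul, smul_eq_mul] at this
        rw [this, mul_comm]
    intro s t hst
    rw [key s, key t, hst]
  · rw [← LinearMap.range_eq_top]
    by_contra hne
    -- If all linear forms took values in `P`, the dual family would kill the fiber at `P`, against
    -- rank one.
    obtain ⟨P, hP, hle⟩ := Ideal.exists_le_maximal (LinearMap.range (contractLeft R M)) hne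
    have hmem (φ : Module.Dual R M) (x : M) : φ x ∈ P := hle ⟨φ ⊗ₜ x, by simp⟩
    have h1 := hr ⟨P, hP.isPrime⟩
    rw [Module.rankAtStalk_eq] at h1
    have : Subsingleton (P.Fiber M) := by
      refine ⟨fun a b => ?_⟩
      have hz (t : P.ResidueField ⊗[R] M) : t = 0 := by
        induction t with
        | zero => rfl
        | add a b ha hb => rw [ha, hb, add_zero]
        | tmul c x =>
          rw [← hψ x, TensorProduct.tmul_sum]
          refine Finset.sum_eq_zero fun i _ => ?_
          rw [← TensorProduct.smul_tmul, Algebra.smul_def,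
            Ideal.algebraMap_residueField_eq_zero.mpr (hmem _ _), zero_mul,
            TensorProduct.zero_tmul]
      exact (hz a).trans (hz b).symm
    rw [Module.finrank_zero_of_subsingleton] at h1
    exact zero_ne_one h1

end IsProjectiveOfRankOne

/-! ### Reduced zero-dimensional rings and invertible modules over their polynomials. -/

/-- Von Neumann regularity, checked at each maximal ideal: the localization is a field, so `b`
either vanishes there or is a unit. -/
theorem Ring.KrullDimLE.mem_span_singleton_sq {B : Type*} [CommRing B] [IsReduced B]
    [Ring.KrullDimLE 0 B] (b : B) : b ∈ Ideal.span {b ^ 2} := by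
  have h (P : Ideal B) (hP : P.IsMaximal) : ∃ t ∉ P, t * b ∈ Ideal.span {b ^ 2} := by
    by_cases hb : b ∈ P
    · have hfield : IsField (Localization.AtPrime P) := by
        have : Ring.KrullDimLE 0 (Localization.AtPrime P) :=
          .of_isLocalization P (Ideal.mem_minimalPrimes_of_krullDimLE_zero P) _
        exact Ring.KrullDimLE.isField_of_isReduced
      let := hfield.toField
      have h0 : algebraMap B (Localization.AtPrime P) b = 0 := by
        by_contra h
        exact (IsLocalization.AtPrime.isUnit_to_map_iff (Localization.AtPrime P) P b).mp
          (IsUnit.mk0 _ h) hb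
      obtain ⟨t, ht⟩ := (IsLocalization.map_eq_zero_iff P.primeCompl _ b).mp h0
      exact ⟨t, t.2, by rw [ht]; exact zero_mem _⟩
    · exact ⟨b, hb, by rw [← sq]; exact Ideal.mem_span_singleton_self _⟩
  have htop : (Ideal.span {b ^ 2}).colon {b} = ⊤ := by
    by_contra hne
    obtain ⟨P, hP, hle⟩ := Ideal.exists_le_maximal _ hne
    obtain ⟨t, htP, ht⟩ := h P hP
    exact htP (hle (by simpa [Submodule.mem_colon_singleton] using ht))
  have := (Ideal.eq_top_iff_one _).mp htop
  simpa [Submodule.mem_colon_singleton] using this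

/-- If `a = y a²`, then `y a` is an idempotent fixing `a`; idempotents are joined by `e + e' - e
e'`. -/
theorem Ring.KrullDimLE.exists_isIdempotentElem_mul_eq {B : Type*} [CommRing B] [IsReduced B]
    [Ring.KrullDimLE 0 B] {P : Ideal B} (s : Finset B) (hs : ∀ b ∈ s, b ∈ P) :
    ∃ e ∈ P, IsIdempotentElem e ∧ ∀ b ∈ s, e * b = b := by
  classical
  induction s using Finset.induction_on with
  | empty => exact ⟨0, zero_mem _, mul_zero _, by simp⟩
  | insert a s ha ih =>
    obtain ⟨e, heP, he, hes⟩ := ih fun b hb => hs b (Finset.mem_insert_of_mem hb)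
    obtain ⟨y, hy⟩ := Ideal.mem_span_singleton'.mp (Ring.KrullDimLE.mem_span_singleton_sq a)
    have hya : (y * a) * a = a := by linear_combination hy
    have he' : IsIdempotentElem (y * a) := by
      unfold IsIdempotentElem
      linear_combination y * hya
    refine ⟨e + y * a - e * (y * a), ?_, ?_, ?_⟩
    · exact sub_mem (add_mem heP (P.mul_mem_left _ (hs a (Finset.mem_insert_self _ _))))
        (P.mul_mem_right _ heP)
    · unfold IsIdempotentElem at he he' ⊢
      linear_combination (1 - y * a) ^ 2 * he + (1 - e) * he'
    · intro b hb
      rcases Finset.mem_insert.mp hb with rfl | hb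
      · linear_combination (1 - e) * hya
      · linear_combination (1 - y * a) * hes b hb

section ReducedZeroDimensional

variable {B σ : Type*} [CommRing B] (M : Type*) [AddCommGroup M]
  [Module (MvPolynomial σ B) M]

attribute [local instance] MvPolynomial.algebraMvPolynomial in
/-- Modulo a maximal ideal `P` of the coefficients, an invertible module has a generator. -/
theorem Module.Invertible.exists_dual_apply_sub_one_mem [Module.Invertible (MvPolynomial σ B) M]
    (P : Ideal B) [P.IsMaximal] :
    ∃ (m : M) (ψ : Module.Dual (MvPolynomial σ B) M), ∀ d, (ψ m - 1).coeff d ∈ P := by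
  let := Ideal.Quotient.field P
  -- Polynomials over the field `B ⧸ P` form a factorial ring, whose Picard group is trivial.
  have hfree : Module.Free (MvPolynomial σ (B ⧸ P))
      (MvPolynomial σ (B ⧸ P) ⊗[MvPolynomial σ B] M) := inferInstance
  obtain ⟨e⟩ := Module.Invertible.free_iff_linearEquiv.mp hfree
  have hsurj : Function.Surjective
      (algebraMap (MvPolynomial σ B) (MvPolynomial σ (B ⧸ P))) :=
    MvPolynomial.map_surjective _ Ideal.Quotient.mk_surjective
  obtain ⟨m, hm⟩ : ∃ m : M, (1 : MvPolynomial σ (B ⧸ P)) ⊗ₜ[MvPolynomial σ B] m = e.symm 1 := by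
    generalize e.symm 1 = t
    induction t with
    | zero => exact ⟨0, by simp⟩
    | add a b ha hb =>
      obtain ⟨x, hx⟩ := ha
      obtain ⟨y, hy⟩ := hb
      exact ⟨x + y, by rw [TensorProduct.tmul_add, hx, hy]⟩
    | tmul c x =>
      obtain ⟨r, rfl⟩ := hsurj c
      exact ⟨r • x, by rw [← TensorProduct.smul_tmul, Algebra.smul_def, mul_one]⟩
  let φ : M →ₗ[MvPolynomial σ B] MvPolynomial σ (B ⧸ P) :=
    e.toLinearMap.restrictScalars (MvPolynomial σ B) ∘ₗ
      TensorProduct.mk (MvPolynomial σ B) (MvPolynomial σ (B ⧸ P)) M 1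
  obtain ⟨ψ, hψ⟩ := Module.projective_lifting_property
    (Algebra.linearMap (MvPolynomial σ B) (MvPolynomial σ (B ⧸ P))) φ hsurj
  refine ⟨m, ψ, fun d => ?_⟩
  have h1 : algebraMap (MvPolynomial σ B) (MvPolynomial σ (B ⧸ P)) (ψ m) = 1 := by
    have := LinearMap.congr_fun hψ m
    simpa [φ, hm] using this
  have h2 : MvPolynomial.map (Ideal.Quotient.mk P) (ψ m - 1) = 0 := by
    rw [map_sub, map_one, sub_eq_zero]
    exact h1
  rw [← Ideal.Quotient.eq_zero_iff_mem, ← MvPolynomial.coeff_map, h2, MvPolynomial.coeff_zero]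

variable [IsReduced B] [Ring.KrullDimLE 0 B]

/-- Near each maximal ideal an idempotent kills the finitely many coefficients of `ψ m - 1`, so it
is itself a value `ψ m`. Such idempotents generate the unit ideal and are closed under joins, hence
include `1`. -/
theorem Module.Invertible.exists_dual_apply_eq_one [Module.Invertible (MvPolynomial σ B) M] :
    ∃ (m : M) (ψ : Module.Dual (MvPolynomial σ B) M), ψ m = 1 := by
  classical
  let S : Set B := {e | IsIdempotentElem e ∧
    ∃ (m : M) (ψ : Module.Dual (MvPolynomial σ B) M), ψ m = MvPolynomial.C e}
  have htop : Ideal.span S = ⊤ := by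
    by_contra hne
    obtain ⟨P, hP, hle⟩ := Ideal.exists_le_maximal _ hne
    obtain ⟨m, ψ, h⟩ := Module.Invertible.exists_dual_apply_sub_one_mem (σ := σ) M P
    obtain ⟨e, heP, he, hes⟩ := Ring.KrullDimLE.exists_isIdempotentElem_mul_eq (P := P)
      ((ψ m - 1).support.image (ψ m - 1).coeff) (by
        intro b hb
        obtain ⟨d, -, rfl⟩ := Finset.mem_image.mp hb
        exact h d)
    have hkill : MvPolynomial.C (1 - e) * (ψ m - 1) = 0 := by
      ext d
      rw [MvPolynomial.coeff_C_mul, MvPolynomial.coeff_zero]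
      by_cases hd : d ∈ (ψ m - 1).support
      · rw [sub_mul, hes _ (Finset.mem_image_of_mem _ hd), one_mul, sub_self]
      · rw [MvPolynomial.notMem_support_iff.mp hd, mul_zero]
    have hmem : (1 - e) ∈ S := by
      refine ⟨he.one_sub, m, (MvPolynomial.C (1 - e) : MvPolynomial σ B) • ψ, ?_⟩
      rw [LinearMap.smul_apply, smul_eq_mul]
      linear_combination hkill
    refine hP.ne_top ((Ideal.eq_top_iff_one _).mpr ?_)
    have := add_mem (hle (Ideal.subset_span hmem)) heP
    rwa [sub_add_cancel] at this
  have hjoin (x : B) (hx : x ∈ Ideal.span S) : ∃ e ∈ S, e * x = x := by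
    induction hx using Submodule.span_induction with
    | mem x hx => exact ⟨x, hx, hx.1⟩
    | zero => exact ⟨0, ⟨mul_zero _, 0, 0, by simp⟩, mul_zero _⟩
    | smul a x _ ih =>
      obtain ⟨e, he, hx⟩ := ih
      exact ⟨e, he, by rw [smul_eq_mul, mul_left_comm, hx]⟩
    | add x y _ _ hx hy =>
      obtain ⟨e, ⟨he, m, ψ, hm⟩, hx⟩ := hx
      obtain ⟨e', ⟨he', m', ψ', hm'⟩, hy⟩ := hy
      unfold IsIdempotentElem at he he'
      have hC : (MvPolynomial.C e * MvPolynomial.C e : MvPolynomial σ B) = MvPolynomial.C e := by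
        rw [← map_mul, he]
      have hC' : (MvPolynomial.C e' * MvPolynomial.C e' : MvPolynomial σ B) =
        MvPolynomial.C e' := by rw [← map_mul, he']
      -- The idempotents `e` and `e' (1 - e)` are orthogonal, so the cross terms vanish.
      refine ⟨e + e' - e * e', ⟨?_,
        (MvPolynomial.C e : MvPolynomial σ B) • m +
          (MvPolynomial.C (e' * (1 - e)) : MvPolynomial σ B) • m',
        (MvPolynomial.C e : MvPolynomial σ B) • ψ +
          (MvPolynomial.C (e' * (1 - e)) : MvPolynomial σ B) • ψ', ?_⟩, ?_⟩
      · unfold IsIdempotentElem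
        linear_combination (1 - e') ^ 2 * he + (1 - e) * he'
      · simp only [LinearMap.add_apply, LinearMap.smul_apply, map_add, map_smul, smul_eq_mul, hm,
          hm', map_sub, map_mul, map_one]
        generalize ψ m' = u, ψ' m = v, (MvPolynomial.C e : MvPolynomial σ B) = c,
          (MvPolynomial.C e' : MvPolynomial σ B) = c' at *
        have hc0 : c * (1 - c) = 0 := by linear_combination -hC
        linear_combination (c + 1) * hC + (u + v) * c' * hc0 +
          (1 - c) ^ 2 * (c' + 1) * hC' + c' * hC
      · linear_combination (1 - e') * hx + (1 - e) * hy
  obtain ⟨e, ⟨-, m, ψ, hm⟩, he⟩ := hjoin 1 (htop ▸ Submodule.mem_top)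
  rw [mul_one] at he
  exact ⟨m, ψ, by rw [hm, he, map_one]⟩

/-- An invertible module over a polynomial ring over a reduced zero-dimensional ring is free. -/
theorem Module.Invertible.nonempty_linearEquiv_of_krullDimLE_zero
    [Module.Invertible (MvPolynomial σ B) M] :
    Nonempty (M ≃ₗ[MvPolynomial σ B] MvPolynomial σ B) := by
  obtain ⟨m, ψ, h⟩ := Module.Invertible.exists_dual_apply_eq_one (σ := σ) (B := B) M
  refine ⟨LinearEquiv.ofBijective ψ (Module.Invertible.bijective_of_surjective fun r =>
    ⟨r • m, by rw [map_smul, h, smul_eq_mul, mul_one]⟩)⟩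

end ReducedZeroDimensional

/-! ### Kronecker's theorem and integrality of the coefficients. -/

section Integrality

open Polynomial in
theorem Polynomial.monic_reflect {R : Type*} [CommRing R] {f : R[X]} {N : ℕ}
    (hN : f.natDegree ≤ N) (h0 : f.coeff 0 = 1) : (f.reflect N).Monic := by
  refine monic_of_natDegree_le_of_coeff_eq_one N ?_ ?_
  · exact natDegree_reflect_le.trans (max_le le_rfl hN)
  · rw [coeff_reflect, revAt_le le_rfl, Nat.sub_self, h0]

variable {A B σ : Type*} [CommRing A] [CommRing B] [Algebra A B]

/-- The polynomial `f(TX)` in the additional variable `T`. -/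
noncomputable def MvPolynomial.dilate (σ R : Type*) [CommRing R] :
    MvPolynomial σ R →+* Polynomial (MvPolynomial σ R) :=
  MvPolynomial.eval₂Hom (Polynomial.C.comp MvPolynomial.C)
    fun i => Polynomial.C (MvPolynomial.X i) * Polynomial.X

namespace MvPolynomial

theorem eval_one_dilate (f : MvPolynomial σ B) : (dilate σ B f).eval 1 = f := by
  have : (Polynomial.evalRingHom 1).comp (dilate σ B) = RingHom.id _ := by
    ext <;> simp [dilate]
  exact RingHom.congr_fun this f

theorem coeff_zero_dilate (f : MvPolynomial σ B) :
    (dilate σ B f).coeff 0 = C (constantCoeff f) := by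
  have : (Polynomial.evalRingHom 0).comp (dilate σ B) = C.comp constantCoeff := by
    ext <;> simp [dilate]
  simpa [Polynomial.coeff_zero_eq_eval_zero] using RingHom.congr_fun this f

theorem dilate_map (f : MvPolynomial σ A) :
    dilate σ B (map (algebraMap A B) f) = (dilate σ A f).map (map (algebraMap A B)) := by
  have : (dilate σ B).comp (map (algebraMap A B)) =
      (Polynomial.mapRingHom (map (algebraMap A B))).comp (dilate σ A) := by
    ext <;> simp [dilate]
  exact RingHom.congr_fun this f

attribute [local instance] MvPolynomial.algebraMvPolynomial in
/-- Kronecker's theorem for polynomials with constant coefficient `1`. -/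
theorem isIntegral_coeff_of_mul_eq_map [FaithfulSMul A B] {f g : MvPolynomial σ B}
    {h : MvPolynomial σ A} (hf : constantCoeff f = 1) (hg : constantCoeff g = 1)
    (hfg : f * g = map (algebraMap A B) h) (d : σ →₀ ℕ) : IsIntegral A (f.coeff d) := by
  have hh : constantCoeff h = 1 := by
    apply FaithfulSMul.algebraMap_injective A B
    rw [← constantCoeff_map, ← hfg, map_mul, hf, hg, mul_one, map_one]
  refine isIntegral_iff_isIntegral_coeff.mp ?_ d
  -- In `T`, the polynomial `f(TX)` has constant term `1`, so its reversal is monic and divides the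
  -- monic reversal of `h(TX)`. Setting `T = 1` recovers `f`.
  have hint (i : ℕ) : IsIntegral (MvPolynomial σ A) ((dilate σ B f).coeff i) := by
    set N := (dilate σ B f).natDegree with hN
    set N' := (dilate σ B g).natDegree with hN'
    by_cases hi : i ≤ N
    · have hdvd : (dilate σ B f).reflect N ∣
          ((dilate σ A h).reflect (N + N')).map (algebraMap (MvPolynomial σ A) _) := by
        rw [← Polynomial.reflect_map, algebraMap_def, ← dilate_map, ← hfg, map_mul,
          Polynomial.reflect_mul _ _ le_rfl le_rfl]
        exact dvd_mul_right _ _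
      have hdeg : (dilate σ A h).natDegree ≤ N + N' := by
        have hinj : Function.Injective (map (algebraMap A B) : MvPolynomial σ A →+* _) :=
          map_injective _ (FaithfulSMul.algebraMap_injective A B)
        rw [← Polynomial.natDegree_map_eq_of_injective hinj, ← dilate_map, ← hfg, map_mul]
        exact Polynomial.natDegree_mul_le
      have := Polynomial.isIntegral_coeff_of_dvd _ _
        (Polynomial.monic_reflect hdeg (by rw [coeff_zero_dilate, hh, map_one]))
        (Polynomial.monic_reflect le_rfl (by rw [coeff_zero_dilate, hf, map_one])) hdvd (N - i)
      rwa [Polynomial.coeff_reflect, Polynomial.revAt_le (Nat.sub_le _ _),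
        Nat.sub_sub_self hi] at this
    · rw [Polynomial.coeff_eq_zero_of_natDegree_lt (not_le.mp hi)]
      exact isIntegral_zero
  rw [← eval_one_dilate f, Polynomial.eval_eq_sum]
  exact IsIntegral.sum _ fun i _ => by simpa using hint i

end MvPolynomial

/-- Finite families `f`, `g` of elements of `S` with `∑ f i * g i = 1` and all products `f i * g j`
in the image of `R`: coordinates of an invertible `R`-submodule of `S` and of its inverse. -/
structure IsInvertibleFamily {R S ι : Type*} [CommRing R] [CommRing S] [Fintype ι] (ρ : R →+* S)
    (f g : ι → S) : Prop where
  sum_mul : ∑ i, f i * g i = 1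
  mul_mem : ∀ i j, f i * g j ∈ ρ.range

namespace IsInvertibleFamily

variable {ι : Type*} [Fintype ι]

theorem symm {R S : Type*} [CommRing R] [CommRing S] {ρ : R →+* S} {f g : ι → S}
    (h : IsInvertibleFamily ρ f g) : IsInvertibleFamily ρ g f :=
  ⟨by simpa only [mul_comm] using h.sum_mul, fun i j => by rw [mul_comm]; exact h.mul_mem j i⟩

variable {f g : ι → MvPolynomial σ B}

theorem isIntegral_coeff [FaithfulSMul A B]
    (h : IsInvertibleFamily (MvPolynomial.map (algebraMap A B)) f g)
    (hf : ∀ i, MvPolynomial.constantCoeff (f i) ∈ (algebraMap A B).range)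
    (hg : ∀ i, MvPolynomial.constantCoeff (g i) ∈ (algebraMap A B).range)
    (i : ι) (d : σ →₀ ℕ) : IsIntegral A ((f i).coeff d) := by
  classical
  choose a ha using hf
  choose b hb using hg
  choose p hp using h.mul_mem
  have hsum : ∑ i, algebraMap A B (a i) * algebraMap A B (b i) = 1 := by
    simp only [ha, hb, ← map_mul, ← map_sum, h.sum_mul, map_one]
  -- multiples of elements of the span of `f` by `∑ f j (0) g j` have coefficients in `A`
  have key (c : ι → A) (hc : ∑ i, algebraMap A B (c i) * algebraMap A B (a i) = 1) :
      IsIntegral A ((∑ i, MvPolynomial.C (algebraMap A B (c i)) * f i).coeff d) := by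
    refine MvPolynomial.isIntegral_coeff_of_mul_eq_map
      (g := ∑ j, MvPolynomial.C (algebraMap A B (a j)) * g j)
      (h := ∑ i, ∑ j, MvPolynomial.C (c i) * MvPolynomial.C (a j) * p i j) ?_ ?_ ?_ d
    · simpa [← ha] using hc
    · simpa [← hb] using hsum
    · simp only [map_sum, map_mul, hp, Finset.sum_mul_sum, MvPolynomial.map_C]
      exact Finset.sum_congr rfl fun i _ => Finset.sum_congr rfl fun j _ => by ring
  have hb' := key b (by simpa only [mul_comm] using hsum)
  -- The multiple of `∑ b j * f j`, whose constant term is `1`, corrects the constant term of `f i`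
  -- from `a i` to `1`.
  have hi := key (fun j => (Pi.single i 1 : ι → A) j + (1 - a i) * b j) (by
    simp only [map_add, map_mul, add_mul, Finset.sum_add_distrib, mul_assoc, ← Finset.mul_sum]
    rw [Finset.sum_eq_single i (by intro j _ hj; simp [Pi.single_eq_of_ne hj]) (by simp)]
    simp only [mul_comm (algebraMap A B (b _)), hsum]
    simp)
  have hsub : f i = (∑ j, MvPolynomial.C (algebraMap A B ((Pi.single i 1 : ι → A) j +
      (1 - a i) * b j)) * f j) - MvPolynomial.C (algebraMap A B (1 - a i)) *
        ∑ j, MvPolynomial.C (algebraMap A B (b j)) * f j := by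
    simp only [map_add, map_mul, add_mul, Finset.sum_add_distrib, mul_assoc, ← Finset.mul_sum]
    rw [add_sub_cancel_right,
      Finset.sum_eq_single i (by intro j _ hj; simp [Pi.single_eq_of_ne hj]) (by simp)]
    simp
  rw [hsub, MvPolynomial.coeff_sub, MvPolynomial.coeff_C_mul]
  exact hi.sub (isIntegral_algebraMap.mul hb')

end IsInvertibleFamily

end Integrality

/-! ### Invertible families over a field. -/

section Field

/-- If the Picard group of `R` is trivial, an invertible `R`-submodule of `S` is generated by a
unit. -/
theorem IsInvertibleFamily.exists_isUnit {R S ι : Type*} [CommRing R] [CommRing S] [Algebra R S]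
    [Subsingleton (CommRing.Pic R)] [FaithfulSMul R S] [Fintype ι] {f g : ι → S}
    (h : IsInvertibleFamily (algebraMap R S) f g) :
    ∃ u : S, IsUnit u ∧ (∀ i, ∃ a : R, f i = algebraMap R S a * u) ∧
      ∀ i, ∃ b : R, g i * u = algebraMap R S b := by
  classical
  let I := Submodule.span R (Set.range f)
  let J := Submodule.span R (Set.range g)
  have hIJ : I * J = 1 := by
    refine le_antisymm ?_ ?_
    · rw [Submodule.span_mul_span, Submodule.span_le]
      rintro _ ⟨_, ⟨i, rfl⟩, _, ⟨j, rfl⟩, rfl⟩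
      exact Submodule.mem_one.mpr (h.mul_mem i j)
    · rw [Submodule.one_le, ← h.sum_mul]
      exact Submodule.sum_mem _ fun i _ => Submodule.mul_mem_mul
        (Submodule.subset_span ⟨i, rfl⟩) (Submodule.subset_span ⟨i, rfl⟩)
  let U : (Submodule R S)ˣ := ⟨I, J, hIJ, by rw [mul_comm]; exact hIJ⟩
  have : Module.Invertible R I := Module.Invertible.left (Submodule.tensorInvEquiv U)
  obtain ⟨e⟩ := Module.Invertible.free_iff_linearEquiv.mp (inferInstance : Module.Free R I)
  have hfu (i : ι) : f i = algebraMap R S (e ⟨f i, Submodule.subset_span ⟨i, rfl⟩⟩) *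
      (e.symm 1 : I) := by
    rw [← Algebra.smul_def, ← Submodule.coe_smul, ← map_smul, smul_eq_mul, mul_one,
      LinearEquiv.symm_apply_apply]
  refine ⟨(e.symm 1 : I), ?_, fun i => ⟨_, hfu i⟩, fun i => ?_⟩
  · refine IsUnit.of_mul_eq_one
      (∑ i, algebraMap R S (e ⟨f i, Submodule.subset_span ⟨i, rfl⟩⟩) * g i) ?_
    rw [← h.sum_mul, Finset.mul_sum]
    refine Finset.sum_congr rfl fun i _ => ?_
    conv_rhs => rw [hfu i]
    ring
  · have : (e.symm 1 : S) * g i ∈ I * J :=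
      Submodule.mul_mem_mul (e.symm 1 : I).2 (Submodule.subset_span ⟨i, rfl⟩)
    rw [hIJ, Submodule.mem_one] at this
    obtain ⟨b, hb⟩ := this
    exact ⟨b, by rw [hb, mul_comm]⟩

attribute [local instance] MvPolynomial.algebraMvPolynomial in
-- Here `f i = a i * u` with `u` a unit of `L[X]`, a constant `c` because `L` is reduced. Evaluating
-- `∑ f i * g i = 1` at `0` shows that `c` is the inverse of an element of `K`.
theorem IsInvertibleFamily.mem_range_map_of_field {K L ι σ : Type*} [Field K] [CommRing L]
    [Nontrivial L] [IsReduced L] [Algebra K L] [Fintype ι] {f g : ι → MvPolynomial σ L}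
    (h : IsInvertibleFamily (MvPolynomial.map (algebraMap K L)) f g)
    (hg : ∀ i, MvPolynomial.constantCoeff (g i) ∈ (algebraMap K L).range) (i : ι) :
    f i ∈ (MvPolynomial.map (algebraMap K L)).range := by
  have : FaithfulSMul (MvPolynomial σ K) (MvPolynomial σ L) :=
    (faithfulSMul_iff_algebraMap_injective _ _).mpr
      (MvPolynomial.map_injective _ (algebraMap K L).injective)
  obtain ⟨u, hu, hfu, hgu⟩ := IsInvertibleFamily.exists_isUnit
    (R := MvPolynomial σ K) (S := MvPolynomial σ L) h
  choose a ha using hfu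
  obtain ⟨c, hc, rfl⟩ := MvPolynomial.isUnit_iff_eq_C_of_isReduced.mp hu
  simp only [MvPolynomial.algebraMap_def] at ha
  choose y hy using hg
  have h1 : algebraMap K L (∑ i, MvPolynomial.constantCoeff (a i) * y i) * c = 1 := by
    have := congrArg MvPolynomial.constantCoeff h.sum_mul
    simp only [ha, map_sum, map_mul, MvPolynomial.constantCoeff_map, MvPolynomial.constantCoeff_C,
      ← hy, map_one] at this
    rw [← this, map_sum, Finset.sum_mul]
    exact Finset.sum_congr rfl fun i _ => by rw [map_mul]; ring
  have hk : (∑ i, MvPolynomial.constantCoeff (a i) * y i) ≠ 0 := by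
    intro h0
    rw [h0, map_zero, zero_mul] at h1
    exact zero_ne_one h1
  have hck : c = algebraMap K L (∑ i, MvPolynomial.constantCoeff (a i) * y i)⁻¹ := by
    calc c = algebraMap K L ((∑ i, MvPolynomial.constantCoeff (a i) * y i)⁻¹ *
        (∑ i, MvPolynomial.constantCoeff (a i) * y i)) * c := by
          rw [inv_mul_cancel₀ hk, map_one, one_mul]
      _ = _ := by rw [map_mul, mul_assoc, h1, mul_one]
  refine ⟨a i * MvPolynomial.C (∑ i, MvPolynomial.constantCoeff (a i) * y i)⁻¹, ?_⟩
  rw [map_mul, MvPolynomial.map_C, ← hck, ha i]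

end Field

/-! ### Seminormality, the conductor, and localization at a minimal prime over it. -/

/-- `A` is seminormal in the `A`-algebra `B`: the elements of `B` whose square and cube come from
`A` come from `A`. -/
def IsSeminormalIn (A B : Type*) [CommRing A] [CommRing B] [Algebra A B] : Prop :=
  ∀ b : B, b ^ 2 ∈ (algebraMap A B).range → b ^ 3 ∈ (algebraMap A B).range →
    b ∈ (algebraMap A B).range

/-- The conductor of the `A`-algebra `C` in `A`, as an ideal of `C`. -/
def algebraConductor (A C : Type*) [CommRing A] [CommRing C] [Algebra A C] : Ideal C where
  carrier := {x | ∀ y, x * y ∈ (algebraMap A C).range}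
  zero_mem' y := by rw [zero_mul]; exact zero_mem _
  add_mem' hx hy z := by rw [add_mul]; exact add_mem (hx z) (hy z)
  smul_mem' a x hx y := by rw [smul_eq_mul, mul_comm a, mul_assoc]; exact hx _

section

variable {A C : Type*} [CommRing A] [CommRing C] [Algebra A C]

theorem mem_algebraConductor {x : C} :
    x ∈ algebraConductor A C ↔ ∀ y, x * y ∈ (algebraMap A C).range := Iff.rfl

/-- When `x²` is in the conductor, so are `(x y)² = x² y²` and `(x y)³ = x² (x y³)`, up to
membership in `A`, and seminormality applies to `x y`. -/
theorem IsSeminormalIn.isRadical_algebraConductor (h : IsSeminormalIn A C) :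
    (algebraConductor A C).IsRadical := by
  rw [Ideal.isRadical_iff_pow_one_lt 2 one_lt_two]
  intro x hx y
  refine h _ ?_ ?_
  · rw [mul_pow]; exact hx _
  · rw [show (x * y) ^ 3 = x ^ 2 * (x * y ^ 3) by ring]; exact hx _

/-- After localization at `p`, the only prime over `I` is `p`, so `p` is nilpotent modulo `I`
elementwise. -/
theorem Ideal.exists_notMem_mul_pow_mem_of_mem_minimalPrimes {I p : Ideal A}
    (hp : p ∈ I.minimalPrimes) {a : A} (ha : a ∈ p) : ∃ t ∉ p, ∃ k : ℕ, t * a ^ k ∈ I := by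
  have := hp.1.1
  by_contra! hcon
  obtain ⟨q, hq, hIq, hdisj⟩ := Ideal.exists_le_prime_disjoint I
    (p.primeCompl ⊔ Submonoid.powers a) (by
      rw [Set.disjoint_left]
      intro x hxI hx
      obtain ⟨t, ht, _, ⟨k, rfl⟩, rfl⟩ := Submonoid.mem_sup.mp hx
      exact hcon t ht k hxI)
  have hqp : q ≤ p := by
    intro x hx
    by_contra hxp
    exact Set.disjoint_left.mp hdisj hx (Submonoid.mem_sup_left hxp)
  exact Set.disjoint_left.mp hdisj (hp.2 ⟨hq, hIq⟩ hqp ha)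
    (Submonoid.mem_sup_right (Submonoid.mem_powers a))

variable {ι σ : Type*} [Fintype ι]

/-- A normalized invertible family over a reduced ring `L` is defined over the ring of fractions of
the image of `A` in `L`, if this image is a field of fractions of `A ⧸ p` inside `L`. -/
theorem IsInvertibleFamily.exists_notMem_mul_coeff_eq {L : Type*} [CommRing L] [Nontrivial L]
    [IsReduced L] (α : A →+* L) {p : Ideal A} [p.IsPrime] (hkill : ∀ a ∈ p, α a = 0)
    (hunit : ∀ a ∉ p, IsUnit (α a)) {f g : ι → MvPolynomial σ L}
    (h : IsInvertibleFamily (MvPolynomial.map α) f g)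
    (hg : ∀ i, MvPolynomial.constantCoeff (g i) ∈ α.range) (i : ι) (d : σ →₀ ℕ) :
    ∃ s ∉ p, ∃ a, α s * (f i).coeff d = α a := by
  have hlift (y : nonZeroDivisors (A ⧸ p)) : IsUnit (Ideal.Quotient.lift p α hkill y) := by
    obtain ⟨y, hy⟩ := y
    obtain ⟨a, rfl⟩ := Ideal.Quotient.mk_surjective y
    exact hunit a fun ha => nonZeroDivisors.ne_zero hy (Ideal.Quotient.eq_zero_iff_mem.mpr ha)
  let _ : Algebra (FractionRing (A ⧸ p)) L := (IsLocalization.lift hlift).toAlgebra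
  have hτ (a : A) : algebraMap (FractionRing (A ⧸ p)) L
      (algebraMap (A ⧸ p) (FractionRing (A ⧸ p)) (Ideal.Quotient.mk p a)) = α a :=
    IsLocalization.lift_eq hlift _
  have hcomp : (algebraMap (FractionRing (A ⧸ p)) L).comp
      ((algebraMap (A ⧸ p) (FractionRing (A ⧸ p))).comp (Ideal.Quotient.mk p)) = α :=
    RingHom.ext hτ
  have hfam : IsInvertibleFamily (MvPolynomial.map (algebraMap (FractionRing (A ⧸ p)) L)) f g := by
    refine ⟨h.sum_mul, fun i j => ?_⟩
    obtain ⟨q, hq⟩ := h.mul_mem i j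
    exact ⟨MvPolynomial.map
      ((algebraMap (A ⧸ p) (FractionRing (A ⧸ p))).comp (Ideal.Quotient.mk p)) q,
      by rw [MvPolynomial.map_map, hcomp, hq]⟩
  obtain ⟨q, hq⟩ := hfam.mem_range_map_of_field (fun i => by
    obtain ⟨a, ha⟩ := hg i
    exact ⟨_, (hτ a).trans ha⟩) i
  obtain ⟨⟨x, ⟨y, hy⟩⟩, hxy⟩ := IsLocalization.surj (nonZeroDivisors (A ⧸ p)) (q.coeff d)
  obtain ⟨a, rfl⟩ := Ideal.Quotient.mk_surjective x
  obtain ⟨s, rfl⟩ := Ideal.Quotient.mk_surjective y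
  refine ⟨s, fun hs => nonZeroDivisors.ne_zero hy (Ideal.Quotient.eq_zero_iff_mem.mpr hs), a, ?_⟩
  rw [← hτ s, ← hτ a, ← hxy, ← hq, MvPolynomial.coeff_map, map_mul, mul_comm]

/-- `L` is `C ⧸ 𝔠` localized at the image of the complement of `p`. -/
theorem Ideal.exists_localization_quotient.{u, v} {A : Type u} {C : Type v} [CommRing A]
    [CommRing C] [Algebra A C] (𝔠 : Ideal C) (h𝔠 : 𝔠.IsRadical) (p : Ideal A) [p.IsPrime] :
    ∃ (L : Type v) (_ : CommRing L) (_ : IsReduced L) (θ : C →+* L),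
      (∀ x, θ x = 0 ↔ ∃ t ∉ p, algebraMap A C t * x ∈ 𝔠) ∧
        ∀ a ∉ p, IsUnit (θ (algebraMap A C a)) := by
  have hred : IsReduced (C ⧸ 𝔠) := (Ideal.isRadical_iff_quotient_reduced 𝔠).mp h𝔠
  let S : Submonoid (C ⧸ 𝔠) := p.primeCompl.map (algebraMap A (C ⧸ 𝔠))
  refine ⟨Localization S, inferInstance, inferInstance,
    (algebraMap (C ⧸ 𝔠) (Localization S)).comp (Ideal.Quotient.mk 𝔠), fun x => ?_, fun a ha => ?_⟩
  · rw [RingHom.comp_apply, IsLocalization.map_eq_zero_iff S]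
    constructor
    · rintro ⟨⟨_, t, ht, rfl⟩, h0⟩
      exact ⟨t, ht, by rwa [← Ideal.Quotient.eq_zero_iff_mem, map_mul]⟩
    · rintro ⟨t, ht, h0⟩
      refine ⟨⟨_, t, ht, rfl⟩, ?_⟩
      rwa [← Ideal.Quotient.eq_zero_iff_mem, map_mul] at h0
  · exact IsLocalization.map_units (Localization S) (⟨_, a, ha, rfl⟩ : S)

/-- If the ring `A` is seminormal in its extension `C`, localizing at a minimal prime `p`
over the conductor shows that the coefficients of a normalized invertible family are fractions
over `A` with denominators outside `p`. -/
theorem IsSeminormalIn.exists_notMem_smul_coeff_mem (hsn : IsSeminormalIn A C) {p : Ideal A}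
    (hp : p ∈ ((algebraConductor A C).comap (algebraMap A C)).minimalPrimes)
    {f g : ι → MvPolynomial σ C}
    (h : IsInvertibleFamily (MvPolynomial.map (algebraMap A C)) f g)
    (hg : ∀ i, MvPolynomial.constantCoeff (g i) ∈ (algebraMap A C).range) (i : ι) (d : σ →₀ ℕ) :
    ∃ s ∉ p, algebraMap A C s * (f i).coeff d ∈ (algebraMap A C).range := by
  have hprime := hp.1.1
  obtain ⟨L, _, _, θ, hθ, hunit⟩ :=
    Ideal.exists_localization_quotient (algebraConductor A C) hsn.isRadical_algebraConductor p
  have hnt : Nontrivial L := by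
    refine ⟨⟨θ 1, 0, fun h1 => ?_⟩⟩
    obtain ⟨t, ht, ht'⟩ := (hθ _).mp h1
    rw [mul_one] at ht'
    exact ht (hp.1.2 ht')
  -- By minimality of `p` the image of `a` is nilpotent, and `L` is reduced.
  have hkill (a : A) (ha : a ∈ p) : (θ.comp (algebraMap A C)) a = 0 := by
    obtain ⟨t, ht, k, hk⟩ := Ideal.exists_notMem_mul_pow_mem_of_mem_minimalPrimes hp ha
    refine eq_zero_of_pow_eq_zero (n := k) ?_
    rw [RingHom.comp_apply, ← map_pow, ← map_pow]
    exact (hθ _).mpr ⟨t, ht, by rw [← map_mul]; exact hk⟩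
  have hfam : IsInvertibleFamily (MvPolynomial.map (θ.comp (algebraMap A C)))
      (fun i => MvPolynomial.map θ (f i)) fun i => MvPolynomial.map θ (g i) := by
    refine ⟨by simp only [← map_mul, ← map_sum, h.sum_mul, map_one], fun i j => ?_⟩
    obtain ⟨q, hq⟩ := h.mul_mem i j
    exact ⟨q, by rw [← map_mul, ← hq, MvPolynomial.map_map]⟩
  obtain ⟨s, hs, a, hsa⟩ := hfam.exists_notMem_mul_coeff_eq _ hkill hunit (fun i => by
    obtain ⟨a, ha⟩ := hg i
    exact ⟨a, by rw [MvPolynomial.constantCoeff_map, ← ha, RingHom.comp_apply]⟩) i d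
  have h0 : θ (algebraMap A C s * (f i).coeff d - algebraMap A C a) = 0 := by
    rw [map_sub, map_mul, sub_eq_zero, ← MvPolynomial.coeff_map]
    exact hsa
  obtain ⟨t, ht, ht'⟩ := (hθ _).mp h0
  refine ⟨t * s, fun hts => (hprime.mem_or_mem hts).elim ht hs, ?_⟩
  -- The error term is in the conductor, hence already in the image of `A`.
  have := add_mem (mem_algebraConductor.mp ht' 1) (⟨t * a, rfl⟩ : _ ∈ (algebraMap A C).range)
  convert this using 1
  simp only [map_mul]
  ring

/-- Otherwise take `p` minimal over the contracted conductor. Every element of `C` has a denominator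
outside `p`; by finiteness one denominator serves all of `C`, so it lies in the conductor and hence
in `p`. -/
theorem IsSeminormalIn.algebraMap_surjective_of_adjoin_coeff_eq_top [Module.Finite A C]
    (hsn : IsSeminormalIn A C) {f g : ι → MvPolynomial σ C}
    (h : IsInvertibleFamily (MvPolynomial.map (algebraMap A C)) f g)
    (hf : ∀ i, MvPolynomial.constantCoeff (f i) ∈ (algebraMap A C).range)
    (hg : ∀ i, MvPolynomial.constantCoeff (g i) ∈ (algebraMap A C).range)
    (hgen : Algebra.adjoin A {c | ∃ i d, c = (f i).coeff d ∨ c = (g i).coeff d} = ⊤) :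
    Function.Surjective (algebraMap A C) := by
  classical
  by_contra hne
  have htop : (algebraConductor A C).comap (algebraMap A C) ≠ ⊤ := by
    intro h1
    rw [Ideal.comap_eq_top_iff, Ideal.eq_top_iff_one] at h1
    exact hne fun c => by simpa using h1 c
  obtain ⟨p, hp⟩ := Ideal.nonempty_minimalPrimes htop
  have hprime := hp.1.1
  have hall (c : C) : ∃ s ∉ p, algebraMap A C s * c ∈ (algebraMap A C).range := by
    have hc : c ∈ Algebra.adjoin A {c | ∃ i d, c = (f i).coeff d ∨ c = (g i).coeff d} :=
      hgen ▸ Algebra.mem_top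
    induction hc using Algebra.adjoin_induction with
    | mem x hx =>
      obtain ⟨i, d, rfl | rfl⟩ := hx
      · exact hsn.exists_notMem_smul_coeff_mem hp h hg i d
      · exact hsn.exists_notMem_smul_coeff_mem hp h.symm hf i d
    | algebraMap r => exact ⟨1, hprime.one_notMem, by rw [← map_mul]; exact ⟨_, rfl⟩⟩
    | add x y _ _ hx hy =>
      obtain ⟨s, hs, hsx⟩ := hx
      obtain ⟨t, ht, hty⟩ := hy
      refine ⟨s * t, fun hst => (hprime.mem_or_mem hst).elim hs ht, ?_⟩
      have := add_mem (mul_mem (⟨t, rfl⟩ : _ ∈ (algebraMap A C).range) hsx)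
        (mul_mem (⟨s, rfl⟩ : _ ∈ (algebraMap A C).range) hty)
      convert this using 1
      rw [map_mul]
      ring
    | mul x y _ _ hx hy =>
      obtain ⟨s, hs, hsx⟩ := hx
      obtain ⟨t, ht, hty⟩ := hy
      refine ⟨s * t, fun hst => (hprime.mem_or_mem hst).elim hs ht, ?_⟩
      convert mul_mem hsx hty using 1
      rw [map_mul]
      ring
  choose s hs hsc using hall
  obtain ⟨T, hT⟩ := Module.Finite.fg_top (R := A) (M := C)
  have hprod : ∏ c ∈ T, s c ∉ p := fun hmem => by
    obtain ⟨c, -, hc⟩ := (hprime.prod_mem_iff).mp hmem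
    exact hs c hc
  refine hprod (hp.1.2 (fun y => ?_))
  have hy : y ∈ Submodule.span A (T : Set C) := hT ▸ Submodule.mem_top
  induction hy using Submodule.span_induction with
  | mem x hx =>
    rw [← Finset.mul_prod_erase T s hx, map_mul, mul_right_comm]
    exact mul_mem (hsc x) ⟨_, rfl⟩
  | zero => rw [mul_zero]; exact zero_mem _
  | add x y _ _ hx hy => rw [mul_add]; exact add_mem hx hy
  | smul a x _ hx =>
    rw [Algebra.smul_def, mul_left_comm]
    exact mul_mem ⟨_, rfl⟩ hx

end

/-! ### Invertible families when `A` is seminormal in `B`. -/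

section

variable {A B ι σ : Type*} [CommRing A] [CommRing B] [Algebra A B] [FaithfulSMul A B] [Fintype ι]

/-- If `A` is seminormal in `B`, an invertible `A[X]`-submodule of `B[X]` whose value at `0` is `A`
is trivial. -/
theorem IsSeminormalIn.coeff_mem_range (hsn : IsSeminormalIn A B) {f g : ι → MvPolynomial σ B}
    (h : IsInvertibleFamily (MvPolynomial.map (algebraMap A B)) f g)
    (hf : ∀ i, MvPolynomial.constantCoeff (f i) ∈ (algebraMap A B).range)
    (hg : ∀ i, MvPolynomial.constantCoeff (g i) ∈ (algebraMap A B).range) (i : ι) (d : σ →₀ ℕ) :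
    (f i).coeff d ∈ (algebraMap A B).range := by
  let F : ι ⊕ ι → MvPolynomial σ B := Sum.elim f g
  let s : Set B := ⋃ k, (F k).coeff '' (F k).support
  have hsfin : s.Finite := Set.finite_iUnion fun k => (Finset.finite_toSet _).image _
  have hcoeff (k : ι ⊕ ι) (d : σ →₀ ℕ) : (F k).coeff d ∈ Algebra.adjoin A s := by
    by_cases hd : d ∈ (F k).support
    · exact Algebra.subset_adjoin (Set.mem_iUnion.mpr ⟨k, d, hd, rfl⟩)
    · rw [MvPolynomial.notMem_support_iff.mp hd]
      exact zero_mem _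
  have hint : ∀ x ∈ s, IsIntegral A x := by
    intro x hx
    obtain ⟨k | k, d, -, rfl⟩ := Set.mem_iUnion.mp hx
    · exact h.isIntegral_coeff hf hg k d
    · exact h.symm.isIntegral_coeff hg hf k d
  let C := Algebra.adjoin A s
  have hfin : Module.Finite A C :=
    Module.Finite.iff_fg.mpr (fg_adjoin_of_finite hsfin hint)
  have hlift (k : ι ⊕ ι) : F k ∈ (MvPolynomial.map (algebraMap C B)).range :=
    MvPolynomial.mem_range_map_iff_coeffs_subset.mpr (by
      intro c hc
      obtain ⟨d, -, rfl⟩ := MvPolynomial.mem_coeffs_iff.mp hc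
      exact ⟨⟨_, hcoeff k d⟩, rfl⟩)
  choose q hq using hlift
  have hinj : Function.Injective (algebraMap C B) := Subtype.val_injective
  have hpinj : Function.Injective (MvPolynomial.map (σ := σ) (algebraMap C B)) :=
    MvPolynomial.map_injective _ hinj
  have hcomp : (algebraMap C B).comp (algebraMap A C) = algebraMap A B := rfl
  have hdesc {x : C} (hx : algebraMap C B x ∈ (algebraMap A B).range) :
      x ∈ (algebraMap A C).range := by
    obtain ⟨a, ha⟩ := hx
    exact ⟨a, hinj ha⟩
  have hfam : IsInvertibleFamily (MvPolynomial.map (algebraMap A C))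
      (fun i => q (.inl i)) fun i => q (.inr i) := by
    refine ⟨hpinj ?_, fun i j => ?_⟩
    · simp only [map_sum, map_mul, hq, map_one]
      exact h.sum_mul
    · obtain ⟨r, hr⟩ := h.mul_mem i j
      refine ⟨r, hpinj ?_⟩
      rw [MvPolynomial.map_map, hcomp, map_mul, hq, hq]
      exact hr
  -- Seminormality passes to the intermediate ring `C`.
  have hsnC : IsSeminormalIn A C := fun b h2 h3 => by
    obtain ⟨a2, h2⟩ := h2
    obtain ⟨a3, h3⟩ := h3
    exact hdesc (hsn _ ⟨a2, by rw [← map_pow, ← h2]; rfl⟩ ⟨a3, by rw [← map_pow, ← h3]; rfl⟩)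
  have hsurj := hsnC.algebraMap_surjective_of_adjoin_coeff_eq_top hfam
    (fun i => hdesc (by rw [← MvPolynomial.constantCoeff_map, hq]; exact hf i))
    (fun i => hdesc (by rw [← MvPolynomial.constantCoeff_map, hq]; exact hg i)) (by
      have := Algebra.adjoin_adjoin_coe_preimage (R := A) (s := s)
      refine top_unique (this.symm.trans_le (Algebra.adjoin_mono ?_))
      rintro ⟨x, hxC⟩ hx
      obtain ⟨k | k, d, -, hd⟩ := Set.mem_iUnion.mp (show x ∈ s from hx)
      · refine ⟨k, d, .inl (hinj ?_)⟩
        rw [← MvPolynomial.coeff_map, hq]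
        exact hd.symm
      · refine ⟨k, d, .inr (hinj ?_)⟩
        rw [← MvPolynomial.coeff_map, hq]
        exact hd.symm)
  obtain ⟨a, ha⟩ := hsurj ⟨_, hcoeff (.inl i) d⟩
  exact ⟨a, congrArg Subtype.val ha⟩

end

/-! ### Seminormal towers and the seminormalization. -/

section Tower

variable (A B : Type*) [CommRing A] [CommRing B] [Algebra A B]

/-- The subalgebras of `B` obtained from `A` by successively adjoining finitely many elements whose
square and cube are already available. -/
inductive IsSeminormalTower : Subalgebra A B → Prop
  | bot : IsSeminormalTower ⊥
  | step (T : Subalgebra A B) (c : B) (hT : IsSeminormalTower T) (h2 : c ^ 2 ∈ T)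
      (h3 : c ^ 3 ∈ T) : IsSeminormalTower (T ⊔ Algebra.adjoin A {c})

variable {A B}

/-- The steps leading to `T'` remain valid on top of `T`; towers are thus directed and their union
is a subalgebra. -/
theorem IsSeminormalTower.sup {T T' : Subalgebra A B} (hT : IsSeminormalTower A B T)
    (hT' : IsSeminormalTower A B T') : IsSeminormalTower A B (T ⊔ T') := by
  induction hT' with
  | bot => rwa [sup_bot_eq]
  | step T' c _ h2 h3 ih =>
    rw [← sup_assoc]
    exact .step _ c ih (le_sup_right (a := T) h2) (le_sup_right (a := T) h3)

variable (A B) in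
/-- The seminormalization of `A` in `B`: the union of the seminormal towers. -/
def seminormalization : Subalgebra A B where
  carrier := {b | ∃ T, IsSeminormalTower A B T ∧ b ∈ T}
  mul_mem' := by
    rintro x y ⟨T, hT, hx⟩ ⟨T', hT', hy⟩
    exact ⟨_, hT.sup hT', mul_mem (le_sup_left (a := T) hx) (le_sup_right (a := T) hy)⟩
  add_mem' := by
    rintro x y ⟨T, hT, hx⟩ ⟨T', hT', hy⟩
    exact ⟨_, hT.sup hT', add_mem (le_sup_left (a := T) hx) (le_sup_right (a := T) hy)⟩
  algebraMap_mem' a := ⟨⊥, .bot, Subalgebra.algebraMap_mem _ a⟩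

/-- The square and the cube lie in a common tower, which one more step extends by the element. -/
theorem isSeminormalIn_seminormalization : IsSeminormalIn (seminormalization A B) B := by
  rintro c ⟨⟨x, T, hT, hx⟩, h2⟩ ⟨⟨y, T', hT', hy⟩, h3⟩
  replace h2 : x = c ^ 2 := h2
  replace h3 : y = c ^ 3 := h3
  subst h2 h3
  exact ⟨⟨c, _, .step _ c (hT.sup hT') (le_sup_left (a := T) hx) (le_sup_right (a := T) hy),
    le_sup_right (a := T ⊔ T') (Algebra.self_mem_adjoin_singleton A c)⟩, rfl⟩

theorem exists_isSeminormalTower_of_finite {s : Set B} (hs : s.Finite)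
    (h : s ⊆ seminormalization A B) : ∃ T, IsSeminormalTower A B T ∧ s ⊆ T := by
  induction s, hs using Set.Finite.induction_on with
  | empty => exact ⟨⊥, .bot, Set.empty_subset _⟩
  | @insert a s _ _ ih =>
    obtain ⟨T, hT, hsT⟩ := ih ((Set.subset_insert _ _).trans h)
    obtain ⟨T', hT', ha⟩ := h (Set.mem_insert a s)
    exact ⟨_, hT.sup hT', Set.insert_subset (le_sup_right (a := T) ha)
      (hsT.trans (le_sup_left (a := T)))⟩

theorem IsSeminormalTower.exists_eq_adjoin_range {T : Subalgebra A B}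
    (hT : IsSeminormalTower A B T) :
    ∃ (m : ℕ) (c : Fin m → B),
      (∀ i : Fin m, c i ^ 2 ∈ Algebra.adjoin A (c '' {j | j < i}) ∧
        c i ^ 3 ∈ Algebra.adjoin A (c '' {j | j < i})) ∧ T = Algebra.adjoin A (Set.range c) := by
  induction hT with
  | bot => exact ⟨0, Fin.elim0, fun i => i.elim0, by simp⟩
  | step T x _ h2 h3 ih =>
    obtain ⟨m, c, hc, rfl⟩ := ih
    have hlast : (Fin.snoc c x : Fin (m + 1) → B) '' {j | j < Fin.last m} = Set.range c := by
      ext b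
      constructor
      · rintro ⟨j, hj, rfl⟩
        obtain ⟨j, rfl⟩ := Fin.exists_castSucc_eq.mpr (ne_of_lt hj)
        exact ⟨j, by simp⟩
      · rintro ⟨j, rfl⟩
        exact ⟨j.castSucc, Fin.castSucc_lt_last j, by simp⟩
    have hcast (i : Fin m) : (Fin.snoc c x : Fin (m + 1) → B) '' {j | j < i.castSucc} =
        c '' {j | j < i} := by
      ext b
      constructor
      · rintro ⟨j, hj, rfl⟩
        obtain ⟨j, rfl⟩ := Fin.exists_castSucc_eq.mpr (ne_of_lt (hj.trans (Fin.castSucc_lt_last i)))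
        exact ⟨j, Fin.castSucc_lt_castSucc_iff.mp hj, by simp⟩
      · rintro ⟨j, hj, rfl⟩
        exact ⟨j.castSucc, Fin.castSucc_lt_castSucc_iff.mpr hj, by simp⟩
    refine ⟨m + 1, Fin.snoc c x, fun i => ?_, ?_⟩
    · induction i using Fin.lastCases with
      | last => rw [hlast, Fin.snoc_last]; exact ⟨h2, h3⟩
      | cast i => rw [hcast, Fin.snoc_castSucc]; exact hc i
    · rw [← Algebra.adjoin_union]
      congr 1
      rw [Fin.range_snoc, Set.union_singleton]

end Tower

/-! ### Modules realized as submodules of a ring. -/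

section Realization

/-- The `R`-module `M` is realized by the families `f`, `g` of elements of `S`: there is a semilinear
map `φ` from `M` to `S`, and a generating family `m` of `M` with `φ (m i) = f i` whose dual family
of linear forms is the multiplication by `g i`. -/
def IsRealizedBy {R S ι : Type*} [CommRing R] [CommRing S] [Fintype ι] (ρ : R →+* S) (f g : ι → S)
    (M : Type*) [AddCommGroup M] [Module R M] : Prop :=
  ∃ (m : ι → M) (ψ : ι → Module.Dual R M) (φ : M →ₛₗ[ρ] S), (∀ x, ∑ i, ψ i x • m i = x) ∧
    (∀ i x, g i * φ x = ρ (ψ i x)) ∧ ∀ i, φ (m i) = f i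

variable {R S ι : Type*} [CommRing R] [CommRing S] [Fintype ι] {M : Type*} [AddCommGroup M]
  [Module R M]

theorem IsProjectiveOfRankOne.invertible_changeOfRing (hM : IsProjectiveOfRankOne R M)
    (ρ : R →+* S) : Module.Invertible S (ChangeOfRing ρ M) := by
  let _ : Algebra R S := ρ.toAlgebra
  have := hM.invertible
  exact inferInstanceAs (Module.Invertible S (S ⊗[R] M))

theorem Module.Free.changeOfRing [Module.Free R M] (ρ : R →+* S) :
    Module.Free S (ChangeOfRing ρ M) := by
  let _ : Algebra R S := ρ.toAlgebra
  exact inferInstanceAs (Module.Free S (S ⊗[R] M))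

/-- `f i` is the image of the generator `m i` under `e`, and `g i` the value of the extended form `ψ
i` at the basis vector `e.symm 1`. -/
theorem exists_isInvertibleFamily_isRealizedBy [Module.Finite R M] [Module.Projective R M]
    (ρ : R →+* S) (e : ChangeOfRing ρ M ≃ₗ[S] S) :
    ∃ (k : ℕ) (f g : Fin k → S), IsInvertibleFamily ρ f g ∧ IsRealizedBy ρ f g M := by
  let _ : Algebra R S := ρ.toAlgebra
  replace e : S ⊗[R] M ≃ₗ[S] S := e
  obtain ⟨k, m, ψ, hψ⟩ := Module.Projective.exists_finite_dual_family R M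
  let Ψ (i : Fin k) : S ⊗[R] M →ₗ[S] S := (Algebra.linearMap R S ∘ₗ ψ i).liftBaseChange S
  have hΨ (t : S ⊗[R] M) : ∑ i, Ψ i t • (1 ⊗ₜ[R] m i : S ⊗[R] M) = t := by
    induction t with
    | zero => simp
    | add a b ha hb => simp only [map_add, add_smul, Finset.sum_add_distrib, ha, hb]
    | tmul c x =>
      conv_rhs => rw [← hψ x, TensorProduct.tmul_sum]
      refine Finset.sum_congr rfl fun i _ => ?_
      simp [Ψ, TensorProduct.smul_tmul', Algebra.smul_def, mul_comm]
  let φ : M →ₛₗ[ρ] S :=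
    { toFun := fun x => e (1 ⊗ₜ x)
      map_add' := fun x y => by rw [TensorProduct.tmul_add, map_add]
      map_smul' := fun r x => by
        rw [TensorProduct.tmul_smul, ← algebraMap_smul S r, map_smul]
        rfl }
  have hg (i : Fin k) (x : M) : Ψ i (e.symm 1) * φ x = ρ (ψ i x) := by
    rw [mul_comm, ← smul_eq_mul, ← map_smul, ← map_smul, smul_eq_mul, mul_one]
    simp only [φ, Ψ, LinearMap.coe_mk, AddHom.coe_mk, LinearEquiv.symm_apply_apply,
      LinearMap.liftBaseChange_tmul, one_smul]
    rfl
  refine ⟨k, fun i => φ (m i), fun i => Ψ i (e.symm 1), ⟨?_, fun i j => ?_⟩,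
    m, ψ, φ, hψ, hg, fun i => rfl⟩
  · have := congrArg e (hΨ (e.symm 1))
    rw [map_sum, LinearEquiv.apply_symm_apply] at this
    refine (Finset.sum_congr rfl fun i _ => ?_).trans this
    rw [map_smul, smul_eq_mul, mul_comm]
    rfl
  · exact ⟨_, (hg j (m i)).symm.trans (mul_comm _ _)⟩

/-- Serves for evaluation at `0`, for enlarging the coefficients and for extension to polynomials
alike. -/
theorem IsRealizedBy.changeOfRing {R' S' : Type*} [CommRing R'] [CommRing S'] {ρ : R →+* S}
    {f g : ι → S} (h : IsRealizedBy ρ f g M) (ρ' : R' →+* S') (r : R →+* R') (s : S →+* S')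
    (hcomm : s.comp ρ = ρ'.comp r) :
    IsRealizedBy ρ' (fun i => s (f i)) (fun i => s (g i)) (ChangeOfRing r M) := by
  obtain ⟨m, ψ, φ, hψ, hg, hf⟩ := h
  let _ : Algebra R R' := r.toAlgebra
  let _ : Algebra R' S' := ρ'.toAlgebra
  let _ : Module R S' := Module.compHom S' (ρ'.comp r)
  have : IsScalarTower R R' S' := ⟨fun a b c => by
    change ρ' (r a * b) * c = ρ' (r a) * (ρ' b * c)
    rw [map_mul, mul_assoc]⟩
  change IsRealizedBy ρ' _ _ (R' ⊗[R] M)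
  let Ψ (i : ι) : R' ⊗[R] M →ₗ[R'] R' := (Algebra.linearMap R R' ∘ₗ ψ i).liftBaseChange R'
  let l : M →ₗ[R] S' :=
    { toFun := fun x => s (φ x)
      map_add' := fun x y => by rw [map_add, map_add]
      map_smul' := fun a x => by
        rw [map_smulₛₗ, smul_eq_mul, map_mul]
        change s.comp ρ a * _ = ρ'.comp r a * _
        rw [hcomm] }
  let Φ : R' ⊗[R] M →ₛₗ[ρ'] S' :=
    { toFun := l.liftBaseChange R'
      map_add' := map_add _
      map_smul' := fun a x => map_smul (l.liftBaseChange R') a x }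
  have hΦ (a : R') (x : M) : Φ (a ⊗ₜ x) = ρ' a * s (φ x) := LinearMap.liftBaseChange_tmul ..
  have hΨ (i : ι) (a : R') (x : M) : Ψ i (a ⊗ₜ x) = a * r (ψ i x) :=
    LinearMap.liftBaseChange_tmul ..
  refine ⟨fun i => 1 ⊗ₜ m i, Ψ, Φ, fun t => ?_, fun i t => ?_, fun i => ?_⟩
  · induction t with
    | zero => simp
    | add a b ha hb => simp only [map_add, add_smul, Finset.sum_add_distrib, ha, hb]
    | tmul c x =>
      conv_rhs => rw [← hψ x, TensorProduct.tmul_sum]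
      refine Finset.sum_congr rfl fun i _ => ?_
      rw [hΨ, TensorProduct.smul_tmul', ← TensorProduct.smul_tmul, smul_eq_mul, mul_one,
        mul_comm, Algebra.smul_def]
      rfl
  · induction t with
    | zero => simp
    | add a b ha hb => simp only [map_add, mul_add, ha, hb]
    | tmul c x =>
      rw [hΦ, hΨ, map_mul, ← RingHom.comp_apply ρ' r, ← hcomm, RingHom.comp_apply, ← hg, map_mul]
      ring
  · rw [hΦ, map_one, one_mul, hf]

/-- Modules realized by families generating the same submodule are isomorphic. -/
theorem IsRealizedBy.nonempty_linearEquiv {ι' N : Type*} [Fintype ι'] [AddCommGroup N] [Module R N]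
    {ρ : R →+* S} (hρ : Function.Injective ρ) {f g : ι → S} {f' g' : ι' → S}
    (h : IsRealizedBy ρ f g M) (h' : IsRealizedBy ρ f' g' N)
    (hf : ∀ i, ∃ a : ι' → R, f i = ∑ j, ρ (a j) * f' j)
    (hf' : ∀ j, ∃ a : ι → R, f' j = ∑ i, ρ (a i) * f i) : Nonempty (M ≃ₗ[R] N) := by
  obtain ⟨m, ψ, φ, hψ, hg, hm⟩ := h
  obtain ⟨m', ψ', φ', hψ', hg', hm'⟩ := h'
  let _ : Module R S := Module.compHom S ρ
  let Φ : M →ₗ[R] S := { toFun := φ, map_add' := map_add φ, map_smul' := map_smulₛₗ φ }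
  let Φ' : N →ₗ[R] S := { toFun := φ', map_add' := map_add φ', map_smul' := map_smulₛₗ φ' }
  -- If `φ x = 0`, each `ρ (ψ i x) = g i * φ x` vanishes, so every dual coordinate of `x` is zero.
  have hinj : Function.Injective Φ := by
    refine (injective_iff_map_eq_zero Φ).mpr fun x hx => ?_
    rw [← hψ x]
    refine Finset.sum_eq_zero fun i _ => ?_
    rw [hρ ((hg i x).symm.trans (by rw [show φ x = 0 from hx, mul_zero, map_zero])), zero_smul]
  have hinj' : Function.Injective Φ' := by
    refine (injective_iff_map_eq_zero Φ').mpr fun x hx => ?_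
    rw [← hψ' x]
    refine Finset.sum_eq_zero fun i _ => ?_
    rw [hρ ((hg' i x).symm.trans (by rw [show φ' x = 0 from hx, mul_zero, map_zero])), zero_smul]
  have hrange : LinearMap.range Φ = LinearMap.range Φ' := by
    refine le_antisymm ?_ ?_
    · rintro _ ⟨x, rfl⟩
      rw [← hψ x, map_sum]
      refine Submodule.sum_mem _ fun i _ => ?_
      rw [map_smul]
      refine Submodule.smul_mem _ _ ?_
      obtain ⟨a, ha⟩ := hf i
      refine ⟨∑ j, a j • m' j, ?_⟩
      rw [map_sum, show Φ (m i) = f i from hm i, ha]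
      refine Finset.sum_congr rfl fun j _ => ?_
      rw [map_smul, ← hm']
      rfl
    · rintro _ ⟨x, rfl⟩
      rw [← hψ' x, map_sum]
      refine Submodule.sum_mem _ fun i _ => ?_
      rw [map_smul]
      refine Submodule.smul_mem _ _ ?_
      obtain ⟨a, ha⟩ := hf' i
      refine ⟨∑ j, a j • m j, ?_⟩
      rw [map_sum, show Φ' (m' i) = f' i from hm' i, ha]
      refine Finset.sum_congr rfl fun j _ => ?_
      rw [map_smul, ← hm]
      rfl
  exact ⟨LinearEquiv.ofInjective Φ hinj ≪≫ₗ LinearEquiv.ofEq _ _ hrange ≪≫ₗ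
    (LinearEquiv.ofInjective Φ' hinj').symm⟩

end Realization

/-! ### Normalization at the origin. -/

section Normalization

variable {A B ι σ : Type*} [CommRing A] [CommRing B] [Algebra A B] [Fintype ι]

open MvPolynomial in
/-- The product of an invertible submodule of `B[X]` and the inverse of its value at `0`. -/
theorem IsInvertibleFamily.mul_constantCoeff {f g : ι → MvPolynomial σ B}
    (h : IsInvertibleFamily (map (algebraMap A B)) f g) :
    IsInvertibleFamily (map (algebraMap A B))
      (fun i : ι × ι => f i.1 * C (constantCoeff (g i.2)))
      fun i => g i.1 * C (constantCoeff (f i.2)) := by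
  have hconst (i j : ι) : constantCoeff (f i) * constantCoeff (g j) ∈ (algebraMap A B).range := by
    obtain ⟨q, hq⟩ := h.mul_mem i j
    exact ⟨constantCoeff q, by rw [← map_mul, ← hq, constantCoeff_map]⟩
  refine ⟨?_, fun i j => ?_⟩
  · have h0 := congrArg (fun p => C (σ := σ) (constantCoeff p)) h.sum_mul
    simp only [map_sum, map_mul, map_one] at h0
    rw [Fintype.sum_prod_type]
    calc _ = (∑ i, f i * g i) *
          ∑ j, C (σ := σ) (constantCoeff (f j)) * C (constantCoeff (g j)) := by
          rw [Finset.sum_mul_sum]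
          exact Finset.sum_congr rfl fun i _ => Finset.sum_congr rfl fun j _ => by ring
      _ = 1 := by rw [h.sum_mul, h0, mul_one]
  · obtain ⟨a, ha⟩ := hconst j.2 i.2
    have := MulMemClass.mul_mem (h.mul_mem i.1 j.1)
      (⟨C a, map_C _ a⟩ : C (algebraMap A B a) ∈ (map (algebraMap A B)).range)
    rw [ha, map_mul] at this
    convert this using 1
    ring

open MvPolynomial in
theorem IsInvertibleFamily.constantCoeff_mul_mem {f g : ι → MvPolynomial σ B}
    (h : IsInvertibleFamily (map (algebraMap A B)) f g) (i j : ι) :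
    constantCoeff (f i * C (constantCoeff (g j))) ∈ (algebraMap A B).range := by
  obtain ⟨q, hq⟩ := h.mul_mem i j
  exact ⟨constantCoeff q, by
    rw [map_mul, constantCoeff_C, ← map_mul, ← hq, constantCoeff_map]⟩

open MvPolynomial in
-- The seminormal case, over the seminormalization, applies to the normalized family; its finitely
-- many coefficients fit in a single tower.
theorem IsInvertibleFamily.exists_isSeminormalTower {f g : ι → MvPolynomial σ B}
    (h : IsInvertibleFamily (map (algebraMap A B)) f g) :
    ∃ T, IsSeminormalTower A B T ∧
      (∀ i j, f i * C (constantCoeff (g j)) ∈ (map (algebraMap T B)).range) ∧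
      ∀ i j, g i * C (constantCoeff (f j)) ∈ (map (algebraMap T B)).range := by
  have hup : IsInvertibleFamily (map (algebraMap (seminormalization A B) B))
      (fun i : ι × ι => f i.1 * C (constantCoeff (g i.2)))
      fun i => g i.1 * C (constantCoeff (f i.2)) := by
    refine ⟨h.mul_constantCoeff.sum_mul, fun i j => ?_⟩
    obtain ⟨q, hq⟩ := h.mul_constantCoeff.mul_mem i j
    exact ⟨map (algebraMap A (seminormalization A B)) q, by rw [map_map, ← hq]; rfl⟩
  have hc {b : B} (hb : b ∈ (algebraMap A B).range) :
      b ∈ (algebraMap (seminormalization A B) B).range := by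
    obtain ⟨a, rfl⟩ := hb
    exact ⟨algebraMap A _ a, rfl⟩
  have hf := isSeminormalIn_seminormalization.coeff_mem_range hup
    (fun i => hc (h.constantCoeff_mul_mem i.1 i.2)) fun i => hc (h.symm.constantCoeff_mul_mem i.1 i.2)
  have hg := isSeminormalIn_seminormalization.coeff_mem_range hup.symm
    (fun i => hc (h.symm.constantCoeff_mul_mem i.1 i.2)) fun i => hc (h.constantCoeff_mul_mem i.1 i.2)
  let s : Set B := ⋃ i : ι × ι, ((f i.1 * C (constantCoeff (g i.2))).coeffs : Set B) ∪
    (g i.1 * C (constantCoeff (f i.2))).coeffs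
  have hs : s.Finite :=
    Set.finite_iUnion fun i => (Finset.finite_toSet _).union (Finset.finite_toSet _)
  obtain ⟨T, hT, hsT⟩ := exists_isSeminormalTower_of_finite (A := A) hs (by
    intro b hb
    obtain ⟨i, hb | hb⟩ := Set.mem_iUnion.mp hb
    · obtain ⟨d, -, rfl⟩ := mem_coeffs_iff.mp hb
      obtain ⟨x, hx⟩ := hf i d
      rw [← hx]
      exact x.2
    · obtain ⟨d, -, rfl⟩ := mem_coeffs_iff.mp hb
      obtain ⟨x, hx⟩ := hg i d
      rw [← hx]
      exact x.2)
  refine ⟨T, hT, fun i j => ?_, fun i j => ?_⟩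
  · refine mem_range_map_iff_coeffs_subset.mpr fun b hb => ?_
    exact ⟨⟨b, hsT (Set.mem_iUnion.mpr ⟨(i, j), .inl hb⟩)⟩, rfl⟩
  · refine mem_range_map_iff_coeffs_subset.mpr fun b hb => ?_
    exact ⟨⟨b, hsT (Set.mem_iUnion.mpr ⟨(i, j), .inr hb⟩)⟩, rfl⟩

end Normalization

/-! ### Extendedness over the enlarged coefficient ring. -/

section Descent

variable {A A' B ι : Type*} [CommRing A] [CommRing A'] [CommRing B] [Algebra A A'] [Algebra A B]
  [Algebra A' B] [IsScalarTower A A' B] [FaithfulSMul A' B] [Fintype ι] {M : Type*} [AddCommGroup M]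
  {n : ℕ} [Module (MvPolynomial (Fin n) A) M]

open MvPolynomial in
-- The two modules are realized by the `f i` and the `f j (0)`, which span the same
-- `A'[X]`-submodule: `f i = ∑ (f i * g j (0)) * f j (0)` and `f i (0) = ∑ (g j * f i (0)) * f j`,
-- with bracketed factors in `A'[X]`.
theorem IsRealizedBy.nonempty_changeOfCoeffs_linearEquiv {f g : ι → MvPolynomial (Fin n) B}
    (h : IsRealizedBy (map (algebraMap A B)) f g M)
    (hfg : IsInvertibleFamily (map (algebraMap A B)) f g)
    (hf : ∀ i j, f i * C (constantCoeff (g j)) ∈ (map (algebraMap A' B)).range)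
    (hg : ∀ i j, g i * C (constantCoeff (f j)) ∈ (map (algebraMap A' B)).range) :
    Nonempty (ChangeOfCoeffs n (algebraMap A A') M ≃ₗ[MvPolynomial (Fin n) A']
      ExtendToPoly n A' (ChangeOfRing (algebraMap A A') (AtZero n A M))) := by
  have h₀ : IsRealizedBy (algebraMap A B) (fun i => constantCoeff (f i))
      (fun i => constantCoeff (g i)) (AtZero n A M) :=
    h.changeOfRing _ _ constantCoeff (RingHom.ext fun p => constantCoeff_map _ p)
  have h₁ : IsRealizedBy (map (algebraMap A' B)) f g (ChangeOfCoeffs n (algebraMap A A') M) :=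
    h.changeOfRing _ _ (RingHom.id _) (RingHom.ext fun p => by
      rw [RingHom.comp_apply, RingHom.comp_apply, map_map, ← IsScalarTower.algebraMap_eq]; rfl)
  have h₂ : IsRealizedBy (algebraMap A' B) (fun i => constantCoeff (f i))
      (fun i => constantCoeff (g i)) (ChangeOfRing (algebraMap A A') (AtZero n A M)) :=
    h₀.changeOfRing _ _ (RingHom.id _) (IsScalarTower.algebraMap_eq A A' B)
  have h₃ : IsRealizedBy (map (algebraMap A' B)) (fun i => C (σ := Fin n) (constantCoeff (f i)))
      (fun i => C (constantCoeff (g i)))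
      (ExtendToPoly n A' (ChangeOfRing (algebraMap A A') (AtZero n A M))) :=
    h₂.changeOfRing _ _ C (RingHom.ext fun a => (map_C _ a).symm)
  refine h₁.nonempty_linearEquiv (map_injective _ (FaithfulSMul.algebraMap_injective A' B)) h₃
    (fun i => ?_) fun i => ?_
  · choose a ha using hf i
    refine ⟨a, ?_⟩
    have h0 := congrArg (fun p => C (σ := Fin n) (constantCoeff p)) hfg.sum_mul
    simp only [map_sum, map_mul, map_one] at h0
    simp only [ha]
    refine (mul_one (f i)).symm.trans ?_
    rw [← h0, Finset.mul_sum]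
    exact Finset.sum_congr rfl fun j _ => by ring
  · choose a ha using fun j => hg j i
    refine ⟨a, ?_⟩
    simp only [ha]
    refine (mul_one (C _)).symm.trans ?_
    rw [← hfg.sum_mul, Finset.mul_sum]
    exact Finset.sum_congr rfl fun j _ => by ring

theorem free_changeOfCoeffs_of_free_atZero [Module.Free A (AtZero n A M)]
    (e : ChangeOfCoeffs n (algebraMap A A') M ≃ₗ[MvPolynomial (Fin n) A']
      ExtendToPoly n A' (ChangeOfRing (algebraMap A A') (AtZero n A M))) :
    Module.Free (MvPolynomial (Fin n) A') (ChangeOfCoeffs n (algebraMap A A') M) := by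
  have : Module.Free A' (ChangeOfRing (algebraMap A A') (AtZero n A M)) :=
    Module.Free.changeOfRing _
  have : Module.Free (MvPolynomial (Fin n) A')
      (ExtendToPoly n A' (ChangeOfRing (algebraMap A A') (AtZero n A M))) :=
    Module.Free.changeOfRing _
  exact Module.Free.of_equiv e.symm

end Descent

theorem theoremD2 {B : Type*} [CommRing B] [IsReduced B] [Ring.KrullDimLE 0 B] (A : Subring B)
    (n : ℕ) (M : Type*) [AddCommGroup M] [Module (MvPolynomial (Fin n) A) M]
    (hM : IsProjectiveOfRankOne (MvPolynomial (Fin n) A) M) :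
    ∃ (m : ℕ) (c : Fin m → B),
      (∀ i : Fin m, c i ^ 2 ∈ Algebra.adjoin A (c '' {j | j < i}) ∧
        c i ^ 3 ∈ Algebra.adjoin A (c '' {j | j < i})) ∧
      (Module.Free A (AtZero n A M) →
        Module.Free (MvPolynomial (Fin n) (Algebra.adjoin A (Set.range c)))
          (ChangeOfCoeffs n (algebraMap A (Algebra.adjoin A (Set.range c))) M)) ∧
      Nonempty
        (ChangeOfCoeffs n (algebraMap A (Algebra.adjoin A (Set.range c))) M
          ≃ₗ[MvPolynomial (Fin n) (Algebra.adjoin A (Set.range c))]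
            ExtendToPoly n (Algebra.adjoin A (Set.range c))
              (ChangeOfRing (algebraMap A (Algebra.adjoin A (Set.range c))) (AtZero n A M))) := by
  have := hM.1
  have := hM.2.1
  have := hM.invertible_changeOfRing (MvPolynomial.map (σ := Fin n) (algebraMap A B))
  obtain ⟨e⟩ := Module.Invertible.nonempty_linearEquiv_of_krullDimLE_zero
    (B := B) (σ := Fin n) (ChangeOfRing (MvPolynomial.map (σ := Fin n) (algebraMap A B)) M)
  obtain ⟨k, f, g, hfg, hreal⟩ := exists_isInvertibleFamily_isRealizedBy _ e
  obtain ⟨T, hT, hf, hg⟩ := hfg.exists_isSeminormalTower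
  obtain ⟨m, c, hc, rfl⟩ := hT.exists_eq_adjoin_range
  have hiso := hreal.nonempty_changeOfCoeffs_linearEquiv hfg hf hg
  exact ⟨m, c, hc, fun _ => free_changeOfCoeffs_of_free_atZero hiso.some, hiso⟩
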